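/- There is an infinite sequence of total Boolean functions $f_k:\{0,1\}^{n_k}\to\{0,1\}$ $(k\in\mathbb N)$ with $\deg(f_k)\to\infty$ and $C(f_k)\to\infty$ such that $$C(f_k)\;\ge\;\Omega\bigl(\deg(f_k)^{2-o(1)}\bigr),$$ that is, there are a constant $c>0$ and real numbers $\varepsilon_k\to 0$ with $C(f_k)\ge c\,\deg(f_k)^{2-\varepsilon_k}$ for every $k$. Here $\deg(f)$ is the real polynomial degree of $f:\{0,1\}^n\to\{0,1\}$, the least total degree of a real polynomial $p\in\mathbb R[x_1,\dots,x_n]$ with $p(x)=f(x)$ for all $x\in\{0,1\}^n$. The certificate complexity $C(f)$ is defined as follows. For $x\in\{0,1\}^n$, a certificate for $x$ is a partial input $\rho\in\{0,1,*\}^n$ that agrees with $x$ wherever $\rho$ is not $*$ and is such that $f(x')=f(x)$ for every $x'\in\{0,1\}^n$ which agrees with $\rho$ in the same sense. The size of $\rho$ is the number of its non-$*$ entries, and $C(f)$ is the maximum over all $x\in\{0,1\}^n$ of the least size of a certificate for $x$. -/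

import Mathlib

open Filter Topology

namespace BoolFun

/-- A partial Boolean function on `n` bits; `none` is the undefined output `*`. -/
abbrev Partial (n : ℕ) := (Fin n → Bool) → Option Bool

/-- A total Boolean function, regarded as a partial one that never outputs `*`. -/
def toPartial {n : ℕ} (f : (Fin n → Bool) → Bool) : Partial n := fun x => some (f x)

/-- The input `x` is consistent with the partial input `ρ` (`none` stands for `*`): wherever `ρ`
has a bit, `x` has the same bit. -/
def Consistent {n : ℕ} (ρ : Fin n → Option Bool) (x : Fin n → Bool) : Prop :=
  ∀ i, ∀ b, ρ i = some b → x i = b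

/-- `ρ` is an `S`-certificate for `x`, where `S` is a set of output symbols. -/
def IsCertificate {n : ℕ} (f : Partial n) (S : Set (Option Bool))
    (ρ : Fin n → Option Bool) (x : Fin n → Bool) : Prop :=
  Consistent ρ x ∧ ∀ y, Consistent ρ y → f y ∈ S

/-- The size of a partial input: the number of its entries that are not `*`. -/
def size {n : ℕ} (ρ : Fin n → Option Bool) : ℕ :=
  (Finset.univ.filter fun i => ρ i ≠ none).card

/-- `S`-certificate complexity of `f` at `x`: the least size of an `S`-certificate for `x`.
One exists as soon as `f x ∈ S`, the only case used in `certSet`. -/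
noncomputable def certAt {n : ℕ} (f : Partial n) (S : Set (Option Bool)) (x : Fin n → Bool) : ℕ :=
  sInf {s | ∃ ρ, IsCertificate f S ρ x ∧ size ρ = s}

open Classical in
/-- `S`-certificate complexity of `f`: the maximum over all inputs `x` with `f x ∈ S`
(zero if there are none). -/
noncomputable def certSet {n : ℕ} (f : Partial n) (S : Set (Option Bool)) : ℕ :=
  (Finset.univ.filter fun x => f x ∈ S).sup (certAt f S)

/-- The certificate complexity of `f`: the maximum of its `0`- and `1`-certificate
complexities. -/
noncomputable def certificateComplexity {n : ℕ} (f : Partial n) : ℕ :=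
  max (certSet f {some false}) (certSet f {some true})

/-- A bit as a real number, `0` or `1`. -/
def bit (b : Bool) : ℝ := if b then 1 else 0

/-- The real polynomial `p` represents the total function `f` exactly on the Boolean cube. -/
def Represents {n : ℕ} (p : MvPolynomial (Fin n) ℝ) (f : (Fin n → Bool) → Bool) : Prop :=
  ∀ x, MvPolynomial.eval (fun i => bit (x i)) p = bit (f x)

/-- The real polynomial degree of `f`: the least total degree of a real polynomial that
represents `f`. (One always exists, and the least degree is that of the unique multilinear
one.) -/
noncomputable def degree {n : ℕ} (f : (Fin n → Bool) → Bool) : ℕ :=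
  sInf {d | ∃ p : MvPolynomial (Fin n) ℝ, Represents p f ∧ p.totalDegree = d}

end BoolFun

/-! The functions are DNFs whose terms pairwise conflict: at most one term holds, so the degree is
at most the largest term width, while certifying `0` may require refuting many terms. Let `k = 2 ^
κ`, `|Λ| = k ^ 2`. A term has a pattern `a` of `2 * κ` bits and, for each bit, `k` distinct elements
of `Λ`. At bit `1` it demands ones at these `k` points of the left block; at bit `0`, a one at a
single point `c` of the right block. The demanded zeros make opposite bits conflict: a random family
`W` (`exists_dispersing_family`) keeps them few. Terms with the same pattern conflict on the pointer
stored at address `a`. Widths are thus `k` times a polynomial in `κ`. On `hardInput`, any `k ^ 2 -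
k` queries leave an unqueried address and `k` unqueried indices in every pair of blocks, hence a
term still satisfiable: `C` is of order `k ^ 2`. The `k` common variables force degree at least `k`.
-/

namespace BoolFun

/-! ### Degree and certificates of unambiguous DNFs -/

section DNF

variable {n : ℕ} {T : Type*} [Fintype T]

/-- The value of the DNF whose terms are the partial inputs `σ t` restricted to `D t`. -/
noncomputable def dnf (D : T → Finset (Fin n)) (σ : T → Fin n → Bool) (x : Fin n → Bool) : Bool :=
  open Classical in decide (∃ t, ∀ i ∈ D t, x i = σ t i)

theorem dnf_eq_true {D : T → Finset (Fin n)} {σ : T → Fin n → Bool} {x : Fin n → Bool} :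
    dnf D σ x = true ↔ ∃ t, ∀ i ∈ D t, x i = σ t i := by
  simp [dnf]

/-- The polynomial of a literal: it is one where the variable `i` has the value `b`. -/
noncomputable def literal (i : Fin n) (b : Bool) : MvPolynomial (Fin n) ℝ :=
  if b then MvPolynomial.X i else 1 - MvPolynomial.X i

theorem totalDegree_literal_le (i : Fin n) (b : Bool) : (literal i b).totalDegree ≤ 1 := by
  cases b
  · refine (MvPolynomial.totalDegree_sub _ _).trans ?_
    simp
  · simp [literal]

theorem eval_literal (i : Fin n) (b : Bool) (x : Fin n → Bool) :
    MvPolynomial.eval (fun i => bit (x i)) (literal i b) = if x i = b then 1 else 0 := by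
  cases b <;> cases h : x i <;> simp [literal, bit, h]

/-- Since at most one term holds at any input, the sum of the term monomials takes only the values
`0` and `1`. -/
theorem exists_represents_dnf {D : T → Finset (Fin n)} {σ : T → Fin n → Bool} {d : ℕ}
    (hconf : ∀ t t', t ≠ t' → ∃ i ∈ D t, i ∈ D t' ∧ σ t i ≠ σ t' i)
    (hcard : ∀ t, (D t).card ≤ d) :
    ∃ p : MvPolynomial (Fin n) ℝ, Represents p (dnf D σ) ∧ p.totalDegree ≤ d := by
  classical
  refine ⟨∑ t, ∏ i ∈ D t, literal i (σ t i), fun x => ?_, ?_⟩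
  · simp only [map_sum, map_prod, eval_literal]
    have hprod : ∀ t, (∏ i ∈ D t, if x i = σ t i then (1 : ℝ) else 0) =
        if ∀ i ∈ D t, x i = σ t i then 1 else 0 := fun t => by
      rw [Finset.prod_ite_zero]; simp
    simp only [hprod]
    by_cases h : ∃ t, ∀ i ∈ D t, x i = σ t i
    · rw [dnf_eq_true.2 h]
      obtain ⟨t, ht⟩ := h
      rw [Finset.sum_eq_single t]
      · simp [bit, if_pos ht]
      · intro t' _ hne
        refine if_neg fun ht' => ?_
        obtain ⟨i, hi, hi', hσ⟩ := hconf t' t hne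
        exact hσ ((ht' i hi).symm.trans (ht i hi'))
      · simp
    · have : dnf D σ x = false := by
        rw [← Bool.not_eq_true, dnf_eq_true]; exact h
      rw [this]
      push Not at h
      refine (Finset.sum_eq_zero fun t _ => if_neg ?_).trans (by simp [bit])
      push Not; exact h t
  · refine MvPolynomial.totalDegree_finsetSum_le fun t _ => ?_
    refine (MvPolynomial.totalDegree_finsetProd _ _).trans ?_
    refine (Finset.sum_le_sum fun i _ => totalDegree_literal_le i _).trans ?_
    simpa using hcard t

theorem degree_le {f : (Fin n → Bool) → Bool} {p : MvPolynomial (Fin n) ℝ}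
    (hp : Represents p f) : degree f ≤ p.totalDegree :=
  Nat.sInf_le ⟨p, hp, rfl⟩

/-- The alternating sum over a subcube with free coordinates `Z` kills polynomials of degree
less than `#Z`. -/
theorem alternating_sum_eq_zero (p : MvPolynomial (Fin n) ℝ) (Z : Finset (Fin n))
    (hp : p.totalDegree < Z.card) (x : Fin n → Bool) :
    ∑ U ∈ Z.powerset, (-1 : ℝ) ^ U.card *
      MvPolynomial.eval (fun i => bit (if i ∈ Z then decide (i ∉ U) else x i)) p = 0 := by
  simp only [MvPolynomial.eval_eq, Finset.mul_sum]
  rw [Finset.sum_comm]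
  refine Finset.sum_eq_zero fun m hm => ?_
  -- A monomial of degree below `#Z` misses some `z ∈ Z`, so `U` and `insert z U` contribute
  -- opposite amounts.
  obtain ⟨z, hzZ, hzm⟩ : ∃ z ∈ Z, z ∉ m.support := by
    by_contra! h
    have h1 : Z.card ≤ m.support.card := Finset.card_le_card h
    have h2 : m.support.card ≤ m.sum fun _ e => e := by
      rw [Finsupp.sum, Finset.card_eq_sum_ones]
      exact Finset.sum_le_sum fun i hi => Nat.one_le_iff_ne_zero.2 (Finsupp.mem_support_iff.1 hi)
    have h3 := MvPolynomial.le_totalDegree hm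
    omega
  have key : ∀ U ∈ (Z.erase z).powerset,
      (∏ i ∈ m.support, bit (if i ∈ Z then decide (i ∉ insert z U) else x i) ^ m i) =
      ∏ i ∈ m.support, bit (if i ∈ Z then decide (i ∉ U) else x i) ^ m i := fun U _ =>
    Finset.prod_congr rfl fun i hi => by
      have : i ≠ z := fun h => hzm (h ▸ hi)
      simp [this]
  rw [← Finset.insert_erase hzZ, Finset.sum_powerset_insert (Finset.notMem_erase z Z),
    Finset.insert_erase hzZ, ← Finset.sum_add_distrib]
  refine Finset.sum_eq_zero fun U hU => ?_
  rw [key U hU, Finset.card_insert_of_notMem fun h =>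
    Finset.notMem_erase z Z (Finset.mem_powerset.1 hU h)]
  ring

/-- On the subcube through `x` with free coordinates `Z`, `f` is one only at `U = ∅`, so its
alternating sum is not zero. -/
theorem le_totalDegree_of_forced {f : (Fin n → Bool) → Bool} {p : MvPolynomial (Fin n) ℝ}
    (hp : Represents p f) {Z : Finset (Fin n)} (hZ : ∀ x, f x = true → ∀ i ∈ Z, x i = true)
    {x : Fin n → Bool} (hx : f x = true) : Z.card ≤ p.totalDegree := by
  by_contra! h
  have h0 := alternating_sum_eq_zero p Z h x
  rw [Finset.sum_eq_single ∅] at h0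
  · rw [hp] at h0
    have : (fun i => if i ∈ Z then decide (i ∉ (∅ : Finset (Fin n))) else x i) = x := by
      funext i
      by_cases hi : i ∈ Z
      · simp [hi, hZ x hx i hi]
      · simp [hi]
    rw [this, hx] at h0
    simp [bit] at h0
  · intro U hU hne
    obtain ⟨u, hu⟩ := Finset.nonempty_iff_ne_empty.2 hne
    have huZ := Finset.mem_powerset.1 hU hu
    rw [hp]
    have : f (fun i => if i ∈ Z then decide (i ∉ U) else x i) = false := by
      rw [← Bool.not_eq_true]
      intro hf
      simpa [huZ, hu] using hZ _ hf u huZ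
    rw [this]; simp [bit]
  · simp

theorem le_certificateComplexity {f : (Fin n → Bool) → Bool} {x : Fin n → Bool} {s : ℕ}
    (hx : f x = false)
    (h : ∀ S : Finset (Fin n), S.card < s → ∃ y, f y = true ∧ ∀ i ∈ S, y i = x i) :
    s ≤ certificateComplexity (toPartial f) := by
  classical
  have h1 : s ≤ certAt (toPartial f) {some false} x := by
    refine le_csInf ⟨_, fun i => some (x i), ⟨fun i b hb => by simpa using hb, fun y hy => ?_⟩, rfl⟩ ?_
    · have : y = x := funext fun i => hy i _ rfl
      simp [toPartial, this, hx]
    · rintro _ ⟨ρ, ⟨hρx, hρ⟩, rfl⟩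
      by_contra! hlt
      obtain ⟨y, hy, hyS⟩ := h _ hlt
      have : Consistent ρ y := fun i b hb => by
        rw [hyS i (by simp [hb])]; exact hρx i b hb
      simpa [toPartial, hy] using hρ y this
  refine h1.trans (le_trans ?_ (le_max_left _ _))
  unfold certSet
  exact Finset.le_sup (f := certAt (toPartial f) {some false}) (by simp [toPartial, hx])

/-- Bounds on the degree and the certificate complexity of the function of a pairwise
conflicting DNF, over an arbitrary finite set of variables. -/
theorem exists_of_conflicting_terms {ι : Type*} [Fintype ι] [DecidableEq ι] [Nonempty T]
    (D : T → Finset ι) (σ : T → ι → Bool) (Z : Finset ι) (x : ι → Bool) (d s : ℕ)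
    (hconf : ∀ t t', t ≠ t' → ∃ i ∈ D t, i ∈ D t' ∧ σ t i ≠ σ t' i)
    (hcard : ∀ t, (D t).card ≤ d)
    (hZ : ∀ t, ∀ i ∈ Z, i ∈ D t ∧ σ t i = true)
    (hx : ∀ t, ∃ i ∈ D t, x i ≠ σ t i)
    (hs : ∀ S : Finset ι, S.card < s → ∃ t, ∀ i ∈ S, i ∈ D t → x i = σ t i) :
    ∃ (n : ℕ) (f : (Fin n → Bool) → Bool), Z.card ≤ degree f ∧ degree f ≤ d ∧
      s ≤ certificateComplexity (toPartial f) := by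
  classical
  let e : ι ≃ Fin (Fintype.card ι) := Fintype.equivFin ι
  let D' : T → Finset (Fin (Fintype.card ι)) := fun t => (D t).map e.toEmbedding
  let σ' : T → Fin (Fintype.card ι) → Bool := fun t i => σ t (e.symm i)
  have hmem : ∀ t i, i ∈ D' t ↔ e.symm i ∈ D t := fun t i => by
    simp [D', Finset.mem_map_equiv]
  obtain ⟨p, hp, hpd⟩ := exists_represents_dnf (D := D') (σ := σ') (d := d)
    (fun t t' hne => by
      obtain ⟨i, hi, hi', hσ⟩ := hconf t t' hne
      exact ⟨e i, by simpa [hmem] using hi, by simpa [hmem] using hi', by simpa [σ'] using hσ⟩)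
    (fun t => by simpa [D'] using hcard t)
  refine ⟨_, dnf D' σ', ?_, (degree_le hp).trans hpd, ?_⟩
  · obtain ⟨q, hq, hqd⟩ := Nat.sInf_mem
      (s := {d | ∃ p, Represents p (dnf D' σ') ∧ p.totalDegree = d}) ⟨_, p, hp, rfl⟩
    obtain ⟨t⟩ := ‹Nonempty T›
    have := le_totalDegree_of_forced hq (Z := Z.map e.toEmbedding) (x := σ' t)
      (fun y hy i hi => by
        obtain ⟨t, ht⟩ := dnf_eq_true.1 hy
        obtain ⟨h1, h2⟩ := hZ t (e.symm i) (by simpa [Finset.mem_map_equiv] using hi)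
        rw [ht i ((hmem t i).2 h1)]; exact h2)
      (dnf_eq_true.2 ⟨t, fun _ _ => rfl⟩)
    rw [hqd, Finset.card_map] at this
    exact this
  · refine le_certificateComplexity (x := x ∘ e.symm) ?_ fun S hS => ?_
    · rw [← Bool.not_eq_true, dnf_eq_true]
      rintro ⟨t, ht⟩
      obtain ⟨i, hi, hne⟩ := hx t
      exact hne (by simpa [σ'] using ht (e i) (by simpa [hmem] using hi))
    · obtain ⟨t, ht⟩ := hs (S.map e.symm.toEmbedding) (by simpa using hS)
      refine ⟨fun i => if i ∈ D' t then σ' t i else x (e.symm i),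
        dnf_eq_true.2 ⟨t, fun i hi => by simp [hi]⟩, fun i hi => ?_⟩
      by_cases hD : i ∈ D' t
      · have := ht (e.symm i) (by simpa using hi) ((hmem t i).1 hD)
        simp [hD, σ', this]
      · simp [hD]

end DNF

/-! ### The dispersing family, by counting -/

/-- A small family of sets `W c` such that every set of `k` points meets all but fewer than `k`
of them. -/
theorem exists_dispersing_family {Λ : Type*} [Fintype Λ] [DecidableEq Λ] {κ k : ℕ} (hκ : 1 ≤ κ)
    (hk : k = 2 ^ κ) (hΛ : Fintype.card Λ = k ^ 2) :
    ∃ W : Λ → Finset Λ, (∀ c, (W c).card ≤ k * (4 * κ + 1)) ∧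
      ∀ P : Finset Λ, P.card = k → (Finset.univ.filter fun c => Disjoint (W c) P).card < k := by
  set t := 4 * κ + 1 with ht
  set w := k * t with hw
  set N := k ^ 2 with hN
  have hk0 : 0 < k := by rw [hk]; positivity
  have hkN : k ≤ N := by rw [hN]; nlinarith
  -- This is `(1 - 1 / k) ^ k ≤ 1 / 2`, via Bernoulli's inequality with denominators cleared.
  have hhalf : 2 * (N - k) ^ k ≤ N ^ k := by
    obtain ⟨j, rfl⟩ : ∃ j, k = j + 1 := ⟨k - 1, by omega⟩
    have hsub : N - (j + 1) = (j + 1) * j := by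
      rw [hN]; exact Nat.sub_eq_of_eq_add (by ring)
    have hbern : 2 * j ^ (j + 1) ≤ (j + 1) ^ (j + 1) := by
      have h : ∀ m, j ^ m * (j + m) ≤ (j + 1) ^ m * j := fun m => by
        induction m with
        | zero => simp
        | succ m ih => rw [pow_succ, pow_succ]; nlinarith [Nat.zero_le (j ^ m * m)]
      rcases j.eq_zero_or_pos with rfl | hj
      · simp
      · refine Nat.le_of_mul_le_mul_right (le_trans ?_ (h (j + 1))) hj
        rw [mul_comm 2, mul_assoc]
        exact Nat.mul_le_mul_left _ (by omega)
    rw [hsub, hN, mul_pow, sq, mul_pow]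
    calc 2 * ((j + 1) ^ (j + 1) * j ^ (j + 1)) = (j + 1) ^ (j + 1) * (2 * j ^ (j + 1)) := by ring
      _ ≤ _ := Nat.mul_le_mul_left _ hbern
  -- Union bound: at most `N ^ (2 * k) = 2 ^ (4 * κ * k)` pairs of `k`-sets, each bad with
  -- probability at most `2 ^ (-t * k)`; hence `t = 4 * κ + 1`.
  have hcount : (N ^ k) ^ 2 * ((N - k) ^ w) ^ k < (N ^ w) ^ k := by
    have hk2 : 2 ≤ k := by rw [hk]; exact Nat.le_self_pow (by omega) 2
    have hpos : 0 < N - k := by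
      have : k * 2 ≤ k ^ 2 := by nlinarith
      omega
    have h1 : (N ^ k) ^ 2 < 2 ^ (t * k) := by
      have : (N ^ k) ^ 2 = 2 ^ (4 * κ * k) := by rw [hN, hk]; ring
      rw [this]
      exact Nat.pow_lt_pow_right (by norm_num) (by nlinarith)
    calc (N ^ k) ^ 2 * ((N - k) ^ w) ^ k < 2 ^ (t * k) * ((N - k) ^ w) ^ k :=
          Nat.mul_lt_mul_of_pos_right h1 (by positivity)
      _ = (2 * (N - k) ^ k) ^ (t * k) := by rw [hw]; ring
      _ ≤ (N ^ k) ^ (t * k) := Nat.pow_le_pow_left hhalf _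
      _ = (N ^ w) ^ k := by rw [hw]; ring
  by_contra! hbad
  -- The samplings in which every set indexed by `q.2` avoids `q.1`.
  let B : Finset Λ × Finset Λ → Finset (Λ → Fin w → Λ) := fun q =>
    Fintype.piFinset fun c => if c ∈ q.2 then Fintype.piFinset fun _ => q.1ᶜ else Finset.univ
  let Q := (Finset.univ : Finset Λ).powersetCard k ×ˢ (Finset.univ : Finset Λ).powersetCard k
  have hcover : (Finset.univ : Finset (Λ → Fin w → Λ)) ⊆ Q.biUnion B := by
    intro ω _
    obtain ⟨P, hP, hmiss⟩ := hbad (fun c => Finset.univ.image (ω c))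
      fun c => Finset.card_image_le.trans (by simp)
    obtain ⟨L, hL, hLk⟩ := Finset.exists_subset_card_eq hmiss
    refine Finset.mem_biUnion.2 ⟨(P, L), by simp [Q, Finset.mem_powersetCard, hP, hLk], ?_⟩
    simp only [B, Fintype.mem_piFinset]
    intro c
    by_cases hc : c ∈ L
    · rw [if_pos hc, Fintype.mem_piFinset]
      intro j
      rw [Finset.mem_compl]
      exact Finset.disjoint_left.1 (Finset.mem_filter.1 (hL hc)).2 (by simp)
    · simp [hc]
  have hB : ∀ q ∈ Q, (B q).card = ((N - k) ^ w) ^ k * (N ^ w) ^ (N - k) := by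
    rintro ⟨P, L⟩ hq
    simp only [Q, Finset.mem_product, Finset.mem_powersetCard_univ] at hq
    simp only [B, Fintype.card_piFinset, apply_ite Finset.card, Finset.card_univ,
      Finset.prod_ite, Finset.prod_const, Finset.card_compl, Fintype.card_fin, Fintype.card_fun,
      hΛ, hq.1]
    have h1 : (Finset.univ.filter fun c => c ∈ L) = L := by simp
    have h2 : (Finset.univ.filter fun c => c ∉ L) = Lᶜ := by ext; simp
    rw [h1, h2, Finset.card_compl, hq.2, hΛ]
  have h1 := (Finset.card_le_card hcover).trans (Finset.card_biUnion_le.trans_eq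
    (Finset.sum_congr rfl hB))
  have hQ : Q.card ≤ (N ^ k) ^ 2 := by
    simp only [Q, Finset.card_product, Finset.card_powersetCard, Finset.card_univ, hΛ]
    rw [sq]
    exact Nat.mul_le_mul (Nat.choose_le_pow _ _) (Nat.choose_le_pow _ _)
  simp only [Finset.card_univ, Fintype.card_fun, Fintype.card_fin, hΛ, Finset.sum_const,
    smul_eq_mul] at h1
  have h2 : (N ^ w) ^ N = (N ^ w) ^ k * (N ^ w) ^ (N - k) := by
    rw [← pow_add, Nat.add_sub_cancel' hkN]
  have hpos : 0 < (N ^ w) ^ (N - k) := by positivity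
  rw [h2] at h1
  have h3 : Q.card * (((N - k) ^ w) ^ k * (N ^ w) ^ (N - k)) ≤
      (N ^ k) ^ 2 * ((N - k) ^ w) ^ k * (N ^ w) ^ (N - k) := by
    rw [mul_assoc]; exact Nat.mul_le_mul_right _ hQ
  exact absurd (h1.trans h3) (not_le.2 (Nat.mul_lt_mul_of_pos_right hcount hpos))

/-! ### The pointer construction -/

section Construction

variable {κ k : ℕ}

/-- The variables of the construction, where `Λ = Fin (2 * κ) → Bool`: there are `k` common
variables, `2 * κ` pairs of blocks indexed by `Λ`, and for every `a : Λ` a pointer that encodes a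
`k`-tuple of elements of `Λ` for each pair of blocks. -/
abbrev Var (κ k : ℕ) : Type :=
  Fin k ⊕ (Fin (2 * κ) × ((Fin (2 * κ) → Bool) ⊕ (Fin (2 * κ) → Bool))) ⊕
    ((Fin (2 * κ) → Bool) × Fin (2 * κ) × Fin k × Fin (2 * κ))

/-- The terms of the construction: a pattern and a tuple of pointers. -/
abbrev Term (κ k : ℕ) : Type :=
  (Fin (2 * κ) → Bool) × (Fin (2 * κ) → Fin k ↪ (Fin (2 * κ) → Bool))

/-- The values that a term prescribes. -/
def termVal (t : Term κ k) : Var κ k → Bool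
  | .inl _ => true
  | .inr (.inl (i, .inl _)) => t.1 i
  | .inr (.inl (i, .inr _)) => !t.1 i
  | .inr (.inr (_, i, j, b)) => t.2 i j b

/-- The variables that a term mentions. -/
def termMem [NeZero k] (W : (Fin (2 * κ) → Bool) → Finset (Fin (2 * κ) → Bool)) (t : Term κ k) :
    Var κ k → Prop
  | .inl _ => True
  | .inr (.inl (i, .inl l)) =>
      if t.1 i then l ∈ Finset.univ.image (t.2 i) else l ∈ W (t.2 i 0)
  | .inr (.inl (i, .inr l)) =>
      if t.1 i then Disjoint (W l) (Finset.univ.image (t.2 i)) else l = t.2 i 0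
  | .inr (.inr (a, _, _, _)) => a = t.1

open Classical in
/-- The set of variables that a term mentions. -/
noncomputable def termDom [NeZero k] (W : (Fin (2 * κ) → Bool) → Finset (Fin (2 * κ) → Bool))
    (t : Term κ k) : Finset (Var κ k) :=
  Finset.univ.filter (termMem W t)

theorem card_termDom_le [NeZero k] {W : (Fin (2 * κ) → Bool) → Finset (Fin (2 * κ) → Bool)} {w : ℕ}
    (hkw : 2 * k ≤ w + 1)
    (hW : ∀ c, (W c).card ≤ w)
    (hW' : ∀ P : Finset (Fin (2 * κ) → Bool), P.card = k →
      (Finset.univ.filter fun c => Disjoint (W c) P).card < k) (t : Term κ k) :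
    (termDom W t).card ≤ k + (2 * κ * (w + 1) + 2 * κ * (k * (2 * κ))) := by
  classical
  rw [termDom, Finset.card_filter, Fintype.sum_sum_type, Fintype.sum_sum_type]
  refine add_le_add ?_ (add_le_add ?_ ?_)
  · simp [termMem]
  · rw [Fintype.sum_prod_type]
    refine (Finset.sum_le_card_nsmul _ _ (w + 1) fun i _ => ?_).trans (by simp)
    rw [Fintype.sum_sum_type, ← Finset.card_filter, ← Finset.card_filter]
    by_cases hi : t.1 i
    · have hP : (Finset.univ.image (t.2 i)).card = k := by
        rw [Finset.card_image_of_injective _ (t.2 i).injective]; simp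
      have h2 := hW' _ hP
      simp only [termMem, hi, if_true]
      rw [Finset.filter_mem_eq_inter, Finset.univ_inter, hP]
      omega
    · simp only [termMem, hi, if_false, Bool.false_eq_true]
      rw [Finset.filter_mem_eq_inter, Finset.univ_inter]
      simpa [Finset.filter_eq'] using hW _
  · rw [Fintype.sum_prod_type, Finset.sum_eq_single t.1]
    · simp [termMem]
    · intro a _ ha
      simp [termMem, ha]
    · simp

/-- Where the patterns differ, let `P` be the points of the term with bit `1` and `c` the point of
the other. If `W c` meets `P`, they clash there in the left block; otherwise they clash at `c` in
the right block. -/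
theorem termDom_conflict [NeZero k]
    {W : (Fin (2 * κ) → Bool) → Finset (Fin (2 * κ) → Bool)} {t t' : Term κ k} (hne : t ≠ t') :
    ∃ i ∈ termDom W t, i ∈ termDom W t' ∧ termVal t i ≠ termVal t' i := by
  have key : ∀ (t t' : Term κ k) (i : Fin (2 * κ)), t.1 i = true → t'.1 i = false →
      ∃ v ∈ termDom W t, v ∈ termDom W t' ∧ termVal t v ≠ termVal t' v := by
    intro t t' i h h'
    by_cases hd : Disjoint (W (t'.2 i 0)) (Finset.univ.image (t.2 i))
    · exact ⟨.inr (.inl (i, .inr (t'.2 i 0))), by simp [termDom, termMem, h, hd],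
        by simp [termDom, termMem, h'], by simp [termVal, h, h']⟩
    · obtain ⟨l, hl, hl'⟩ := Finset.not_disjoint_iff.1 hd
      exact ⟨.inr (.inl (i, .inl l)), by simpa [termDom, termMem, h] using hl',
        by simpa [termDom, termMem, h'] using hl, by simp [termVal, h, h']⟩
  by_cases h1 : t.1 = t'.1
  · have h2 : t.2 ≠ t'.2 := fun h2 => hne (Prod.ext h1 h2)
    obtain ⟨i, hi⟩ := Function.ne_iff.1 h2
    obtain ⟨j, hj⟩ := DFunLike.ne_iff.1 hi
    obtain ⟨b, hb⟩ := Function.ne_iff.1 hj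
    exact ⟨.inr (.inr (t.1, i, j, b)), by simp [termDom, termMem],
      by simp [termDom, termMem, h1], by simpa [termVal] using hb⟩
  · obtain ⟨i, hi⟩ := Function.ne_iff.1 h1
    cases h : t.1 i <;> cases h' : t'.1 i
    · simp [h, h'] at hi
    · obtain ⟨v, hv, hv', hne⟩ := key t' t i h' h
      exact ⟨v, hv', hv, hne.symm⟩
    · exact key t t' i h h'
    · simp [h, h'] at hi

/-- The input at which certificates are large. -/
def hardInput : Var κ k → Bool
  | .inl _ => true
  | .inr _ => false

theorem hardInput_not_satisfies [NeZero k]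
    {W : (Fin (2 * κ) → Bool) → Finset (Fin (2 * κ) → Bool)} (hκ : 1 ≤ κ) (t : Term κ k) :
    ∃ i ∈ termDom W t, hardInput i ≠ termVal t i := by
  have i : Fin (2 * κ) := ⟨0, by omega⟩
  cases h : t.1 i
  · exact ⟨.inr (.inl (i, .inr (t.2 i 0))), by simp [termDom, termMem, h],
      by simp [termVal, hardInput, h]⟩
  · exact ⟨.inr (.inl (i, .inl (t.2 i 0))), by simp [termDom, termMem, h],
      by simp [termVal, hardInput, h]⟩

/-- Each variable of `S` spoils at most one index of `Λ`. With address and points chosen among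
unspoiled ones, `S` sees only common variables and demanded zeros of the term. -/
theorem exists_term_of_card_add_le [NeZero k]
    {W : (Fin (2 * κ) → Bool) → Finset (Fin (2 * κ) → Bool)} {S : Finset (Var κ k)}
    (hS : S.card + k ≤ Fintype.card (Fin (2 * κ) → Bool)) :
    ∃ t : Term κ k, ∀ v ∈ S, v ∈ termDom W t → hardInput v = termVal t v := by
  classical
  have hk := NeZero.pos k
  obtain ⟨a, ha⟩ : ∃ a, ∀ v ∈ S, ∀ q, v = .inr (.inr q) → q.1 ≠ a := by
    let g : Var κ k → (Fin (2 * κ) → Bool)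
      | .inr (.inr q) => q.1
      | _ => default
    have : (S.image g).card < (Finset.univ : Finset (Fin (2 * κ) → Bool)).card :=
      Finset.card_image_le.trans_lt (by rw [Finset.card_univ]; omega)
    obtain ⟨a, -, ha⟩ := Finset.exists_mem_notMem_of_card_lt_card this
    refine ⟨a, fun v hv q hq h => ha (Finset.mem_image.2 ⟨v, hv, ?_⟩)⟩
    subst hq; exact h
  have hπ : ∀ i : Fin (2 * κ), ∃ π : Fin k ↪ (Fin (2 * κ) → Bool),
      ∀ v ∈ S, ∀ j, v ≠ .inr (.inl (i, .inl (π j))) ∧ v ≠ .inr (.inl (i, .inr (π j))) := by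
    intro i
    let g : Var κ k → (Fin (2 * κ) → Bool)
      | .inr (.inl (_, .inl l)) => l
      | .inr (.inl (_, .inr l)) => l
      | _ => default
    have hcard : Fintype.card (Fin k) ≤ Fintype.card ↥((S.image g)ᶜ) := by
      rw [Fintype.card_coe, Finset.card_compl, Fintype.card_fin]
      have : (S.image g).card ≤ S.card := Finset.card_image_le
      omega
    obtain ⟨π⟩ := Function.Embedding.nonempty_of_card_le hcard
    refine ⟨π.trans (Function.Embedding.subtype _), fun v hv j => ⟨?_, ?_⟩⟩ <;>
    · rintro rfl
      exact Finset.mem_compl.1 (π j).2 (Finset.mem_image.2 ⟨_, hv, rfl⟩)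
  choose π hπ using hπ
  refine ⟨(a, π), ?_⟩
  rintro (z | ⟨i, l | l⟩ | q) hv hvt
  · rfl
  · cases h : a i
    · simp [hardInput, termVal, h]
    · simp only [termDom, termMem, h, Finset.mem_filter, Finset.mem_univ, true_and, if_true,
        Finset.mem_image] at hvt
      obtain ⟨j, rfl⟩ := hvt
      exact absurd rfl (hπ i _ hv j).1
  · cases h : a i
    · simp only [termDom, termMem, h, Finset.mem_filter, Finset.mem_univ, true_and,
        Bool.false_eq_true, if_false] at hvt
      exact absurd (by rw [hvt]) (hπ i _ hv 0).2
    · simp [hardInput, termVal, h]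
  · exact absurd (by simpa [termDom, termMem] using hvt) (ha _ hv q rfl)

theorem exists_degree_certificateComplexity (hκ : 1 ≤ κ) :
    ∃ (n : ℕ) (f : (Fin n → Bool) → Bool), 2 ^ κ ≤ degree f ∧ degree f ≤ 25 * κ ^ 2 * 2 ^ κ ∧
      4 ^ κ ≤ 2 * certificateComplexity (toPartial f) := by
  classical
  obtain ⟨k, hk⟩ : ∃ k, k = 2 ^ κ := ⟨_, rfl⟩
  have hk2 : 2 ≤ k := by rw [hk]; exact Nat.le_self_pow (by omega) 2
  have : NeZero k := ⟨by omega⟩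
  have hΛ : Fintype.card (Fin (2 * κ) → Bool) = k ^ 2 := by simp [hk]; ring
  obtain ⟨W, hW, hW'⟩ := exists_dispersing_family hκ hk hΛ
  have hT : Nonempty (Term κ k) := by
    obtain ⟨π⟩ := Function.Embedding.nonempty_of_card_le (α := Fin k)
      (β := Fin (2 * κ) → Bool) (by rw [hΛ, Fintype.card_fin]; nlinarith)
    exact ⟨(default, fun _ => π)⟩
  obtain ⟨n, f, h1, h2, h3⟩ := exists_of_conflicting_terms (T := Term κ k) (termDom W) termVal
    (Finset.univ.image Sum.inl) hardInput _ (k ^ 2 - k + 1)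
    (fun _ _ => termDom_conflict) (card_termDom_le (by nlinarith) hW hW')
    (fun t i hi => by
      obtain ⟨z, -, rfl⟩ := Finset.mem_image.1 hi
      simp [termDom, termMem, termVal])
    (hardInput_not_satisfies hκ)
    (fun S hS => exists_term_of_card_add_le (by
      have : k ≤ k ^ 2 := by nlinarith
      rw [hΛ]; omega))
  rw [Finset.card_image_of_injective _ Sum.inl_injective, Finset.card_univ, Fintype.card_fin] at h1
  refine ⟨n, f, hk ▸ h1, h2.trans ?_, ?_⟩
  · rw [← hk]
    nlinarith [Nat.mul_le_mul_right k hκ, Nat.mul_le_mul_right (κ * k) hκ]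
  · have h4 : 4 ^ κ = k ^ 2 := by rw [hk, ← pow_mul, mul_comm, pow_mul]; norm_num
    have : k * 2 ≤ k ^ 2 := by nlinarith
    omega

end Construction

end BoolFun

/-! ### Asymptotics -/

theorem mainTheorem7 :
    ∃ (n : ℕ → ℕ) (f : (k : ℕ) → (Fin (n k) → Bool) → Bool) (ε : ℕ → ℝ) (c : ℝ),
      0 < c ∧
      Tendsto ε atTop (𝓝 0) ∧
      Tendsto (fun k => BoolFun.degree (f k)) atTop atTop ∧
      Tendsto (fun k => BoolFun.certificateComplexity (BoolFun.toPartial (f k))) atTop atTop ∧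
      ∀ k, c * (BoolFun.degree (f k) : ℝ) ^ (2 - ε k) ≤
        (BoolFun.certificateComplexity (BoolFun.toPartial (f k)) : ℝ) := by
  choose n f hlow hupp hcert using fun m : ℕ =>
    BoolFun.exists_degree_certificateComplexity (κ := m + 1) (by omega)
  let B : ℕ → ℝ := fun m => 25 * (m + 1 : ℝ) ^ 2
  let D : ℕ → ℝ := fun m => B m * 2 ^ (m + 1)
  have hB : ∀ m, 1 < B m := fun m => by
    have : (0 : ℝ) ≤ m := m.cast_nonneg
    simp only [B]; nlinarith
  have hpow : ∀ m : ℕ, (1 : ℝ) ≤ 2 ^ (m + 1) := fun m => one_le_pow₀ (by norm_num)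
  have hD : ∀ m, 1 < D m := fun m => by
    have := hB m; have := hpow m
    simp only [D]; nlinarith
  have hlogD : ∀ m, Real.log (D m) = Real.log (B m) + (m + 1) * Real.log 2 := fun m => by
    rw [Real.log_mul (by linarith [hB m]) (by positivity), Real.log_pow]; push_cast; ring
  have hexp : Tendsto (fun m : ℕ => m + 1) atTop atTop := tendsto_add_atTop_nat 1
  -- This `ε` solves `D m ^ (2 - ε m) = 4 ^ (m + 1)`, where `D m` bounds the degree; it vanishes
  -- because `log (B m)` is only of order `log m`.
  refine ⟨n, f, fun m => 2 * Real.log (B m) / Real.log (D m), 1 / 2, by norm_num, ?_, ?_, ?_, ?_⟩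
  · have hlim : Tendsto (fun m : ℕ => 2 * (Real.log 25 / ((m + 1 : ℕ) : ℝ) +
        2 * (Real.log ((m + 1 : ℕ) : ℝ) / ((m + 1 : ℕ) : ℝ))) / Real.log 2) atTop (𝓝 0) := by
      have hcast : Tendsto (fun m : ℕ => ((m + 1 : ℕ) : ℝ)) atTop atTop :=
        tendsto_natCast_atTop_atTop.comp hexp
      have h1 := (tendsto_const_nhds (x := Real.log 25)).div_atTop hcast
      have h2 := (Real.isLittleO_log_id_atTop.tendsto_div_nhds_zero).comp hcast
      simpa using (((h1.add (h2.const_mul 2)).const_mul 2).div_const (Real.log 2))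
    refine squeeze_zero (fun m => ?_) (fun m => ?_) hlim
    · exact div_nonneg (mul_nonneg zero_le_two (Real.log_pos (hB m)).le) (Real.log_pos (hD m)).le
    · have hl2 : 0 < Real.log 2 := Real.log_pos (by norm_num)
      have hm : (0 : ℝ) < m + 1 := by positivity
      have hlogB : Real.log (B m) = Real.log 25 + 2 * Real.log (m + 1) := by
        simp only [B]
        rw [Real.log_mul (by norm_num) (by positivity), Real.log_pow]; push_cast; ring
      calc 2 * Real.log (B m) / Real.log (D m) ≤ 2 * Real.log (B m) / ((m + 1) * Real.log 2) := by
            refine div_le_div_of_nonneg_left ?_ (by positivity) ?_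
            · exact mul_nonneg zero_le_two (Real.log_pos (hB m)).le
            · rw [hlogD]; linarith [Real.log_pos (hB m)]
        _ = _ := by rw [hlogB]; push_cast; field_simp
  · refine tendsto_atTop_mono (fun m => ?_) tendsto_id
    exact (Nat.le_succ m).trans ((Nat.lt_two_pow_self).le.trans (hlow m))
  · refine tendsto_atTop_mono (fun m => ?_) tendsto_id
    have h1 : m + 1 < 2 ^ (m + 1) := Nat.lt_two_pow_self
    have h2 : 4 ^ (m + 1) = 2 ^ (m + 1) * 2 ^ (m + 1) := by
      rw [← mul_pow]; norm_num
    have := hcert m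
    simp only [id]
    nlinarith
  · intro m
    have hlD := Real.log_pos (hD m)
    have hdeg : (BoolFun.degree (f m) : ℝ) ≤ D m := by
      have : (BoolFun.degree (f m) : ℝ) ≤ ((25 * (m + 1) ^ 2 * 2 ^ (m + 1) : ℕ) : ℝ) :=
        Nat.cast_le.2 (hupp m)
      simpa [D, B] using this
    have hε : 2 - 2 * Real.log (B m) / Real.log (D m) =
        2 * ((m + 1) * Real.log 2) / Real.log (D m) := by
      rw [eq_div_iff hlD.ne', sub_mul, div_mul_cancel₀ _ hlD.ne', hlogD]; ring
    have hl2 : 0 < Real.log 2 := Real.log_pos (by norm_num)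
    have hDpow : D m ^ (2 - 2 * Real.log (B m) / Real.log (D m)) = 4 ^ (m + 1) := by
      rw [hε, Real.rpow_def_of_pos (by linarith [hD m]), mul_div_cancel₀ _ hlD.ne',
        show (2 : ℝ) * ((m + 1) * Real.log 2) = Real.log (4 ^ (m + 1)) by
          rw [Real.log_pow, show (4 : ℝ) = 2 ^ 2 by norm_num, Real.log_pow]; push_cast; ring,
        Real.exp_log (by positivity)]
    have hle : (BoolFun.degree (f m) : ℝ) ^ (2 - 2 * Real.log (B m) / Real.log (D m)) ≤
        4 ^ (m + 1) := by
      rw [← hDpow]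
      refine Real.rpow_le_rpow (Nat.cast_nonneg _) hdeg ?_
      rw [hε]; positivity
    have hc : ((4 : ℝ) ^ (m + 1)) ≤
        2 * (BoolFun.certificateComplexity (BoolFun.toPartial (f m)) : ℝ) := by
      exact_mod_cast hcert m
    linarith
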